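/- Let $\alpha,\beta\ge 0$. A $\mathbb{Z}_2\mathbb{Z}_4$-additive code is a subgroup $\mathcal{C}$ of $\mathbb{Z}_2^\alpha\times\mathbb{Z}_4^\beta$. It is of type $(\alpha,\beta;\gamma,\delta;\kappa)$ if $\mathcal{C}\cong\mathbb{Z}_2^\gamma\times\mathbb{Z}_4^\delta$ as a group and $\kappa$ is the dimension of the binary linear code obtained by projecting $\mathcal{C}_b=\{x\in\mathcal{C}: 2x=0\}$ to the $\alpha$ binary coordinates. Its dual is $$\mathcal{C}^\perp=\Big\{v : 2\sum_{i=1}^{\alpha}u_iv_i+\sum_{j=1}^{\beta}u'_jv'_j=0\in\mathbb{Z}_4\ \text{ for all } u=(u\mid u')\in\mathcal{C}\Big\},\qquad v=(v\mid v')\in\mathbb{Z}_2^\alpha\times\mathbb{Z}_4^\beta .$$ The code $\mathcal{C}$ is 1-perfect if its binary image $\Phi(\mathcal{C})\subseteq\mathbb{Z}_2^{\alpha+2\beta}$ is 1-perfect, where $\Phi$ is the identity on the binary coordinates and the Gray map $0\mapsto 00,\ 1\mapsto 01,\ 2\mapsto 11,\ 3\mapsto 10$ on each quaternary coordinate, and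 a binary code is 1-perfect if every binary vector is at Hamming distance at most one from exactly one codeword. **Proposition 2.3.** Let $r,t$ be integers with $2\le r\le t\le 2r$, and let $\mathcal{C}_{r,t}\subseteq\mathbb{Z}_2^\alpha\times\mathbb{Z}_4^\beta$ be any $\mathbb{Z}_2\mathbb{Z}_4$-additive 1-perfect code of binary length $\alpha+2\beta=2^t-1$ with $\alpha=2^r-1$ binary coordinates. Then: (i) $\mathcal{C}_{r,t}$ is of type $(\alpha,\beta;\gamma,\delta;\kappa)$ exactly for $$\alpha=2^r-1,\quad \beta=2^{t-1}-2^{r-1},\quad \gamma=2^r-1-2r+t,\quad \delta=2^{t-1}-2^{r-1}+r-t,\quad \kappa=\gamma.$$ (ii) $(\mathcal{C}_{r,t})^\perp$ is of type $(\bar\alpha,\bar\beta;\bar\gamma,\bar\delta;\bar\kappa)$ exactly for $$\bar\alpha=\alpha,\quad \bar\beta=\beta,\quad \bar\gamma=2r-t,\quad \bar\delta=t-r,\quad \bar\kappa=\bar\gamma.$$ -/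

import Mathlib

/-- The ambient group `ℤ₂^α × ℤ₄^β`; a vector is written `u = (u.1 | u.2)`. -/
abbrev Z2Z4 (α β : ℕ) : Type := (Fin α → ZMod 2) × (Fin β → ZMod 4)

/-- The classical Gray map `ℤ₄ → ℤ₂²`: `0 ↦ 00`, `1 ↦ 01`, `2 ↦ 11`, `3 ↦ 10`. -/
def grayDigit (a : ZMod 4) : Fin 2 → ZMod 2 :=
  if a = 0 then ![0, 0] else if a = 1 then ![0, 1] else if a = 2 then ![1, 1] else ![1, 0]

/-- The extended Gray map `Φ : ℤ₂^α × ℤ₄^β → ℤ₂^(α + 2β)`. The `α + 2β` binary coordinates are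
indexed by `Fin α ⊕ (Fin β × Fin 2)`. -/
def grayMap {α β : ℕ} (u : Z2Z4 α β) : Fin α ⊕ (Fin β × Fin 2) → ZMod 2 :=
  Sum.elim u.1 (fun p => grayDigit (u.2 p.1) p.2)

/-- A binary code is 1-perfect if the Hamming balls of radius one around its codewords partition
the space: every vector is at Hamming distance at most one from exactly one codeword. -/
def IsBinaryOnePerfect {ι : Type*} [Fintype ι] (C : Set (ι → ZMod 2)) : Prop :=
  ∀ v : ι → ZMod 2, ∃! c : ι → ZMod 2, c ∈ C ∧ hammingDist v c ≤ 1

/-- A `ℤ₂ℤ₄`-additive code is 1-perfect if its binary Gray image is 1-perfect. -/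
def IsOnePerfect {α β : ℕ} (C : AddSubgroup (Z2Z4 α β)) : Prop :=
  IsBinaryOnePerfect (grayMap '' (C : Set (Z2Z4 α β)))

/-- The inner product `2 (∑ uᵢ vᵢ) + ∑ u'ⱼ v'ⱼ ∈ ℤ₄`, where the binary coordinates are read as
the quaternary digits zero and one. -/
def innerZ4 {α β : ℕ} (u v : Z2Z4 α β) : ZMod 4 :=
  2 * (∑ i, ((u.1 i).val : ZMod 4) * ((v.1 i).val : ZMod 4)) + ∑ j, u.2 j * v.2 j

theorem innerZ4_zero_right {α β : ℕ} (u : Z2Z4 α β) : innerZ4 u 0 = 0 := by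
  simp [innerZ4]

theorem innerZ4_add_right {α β : ℕ} (u v w : Z2Z4 α β) :
    innerZ4 u (v + w) = innerZ4 u v + innerZ4 u w := by
  have h : ∀ a b c : ZMod 2, (2 : ZMod 4) * ((a.val : ZMod 4) * ((b + c).val : ZMod 4)) =
      2 * ((a.val : ZMod 4) * (b.val : ZMod 4)) + 2 * ((a.val : ZMod 4) * (c.val : ZMod 4)) := by
    decide
  simp only [innerZ4, Finset.mul_sum, Prod.fst_add, Prod.snd_add, Pi.add_apply, h, mul_add,
    Finset.sum_add_distrib]
  abel

/-- The dual code `C^⊥` (all vectors orthogonal to every codeword), as a `ℤ₂ℤ₄`-additive code. -/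
def dualCode {α β : ℕ} (C : AddSubgroup (Z2Z4 α β)) : AddSubgroup (Z2Z4 α β) where
  carrier := {v | ∀ u ∈ C, innerZ4 u v = 0}
  zero_mem' := fun u _ => innerZ4_zero_right u
  add_mem' := fun {v w} hv hw u hu => by rw [innerZ4_add_right, hv u hu, hw u hu, add_zero]
  neg_mem' := fun {v} hv u hu => by
    have h := innerZ4_add_right u v (-v)
    rw [add_neg_cancel, innerZ4_zero_right, hv u hu, zero_add] at h
    exact h.symm

/-- The subcode `C_b` of `C` formed by the codewords of order two and the zero codeword. -/
def orderTwoSubcode {α β : ℕ} (C : AddSubgroup (Z2Z4 α β)) : AddSubgroup (Z2Z4 α β) where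
  carrier := {x | x ∈ C ∧ 2 • x = 0}
  zero_mem' := ⟨C.zero_mem, smul_zero 2⟩
  add_mem' := fun {x y} hx hy => ⟨C.add_mem hx.1 hy.1, by rw [smul_add, hx.2, hy.2, add_zero]⟩
  neg_mem' := fun {x} hx => ⟨C.neg_mem hx.1, by rw [smul_neg, hx.2, neg_zero]⟩

/-- The punctured code `C_X`: the projection of `C` to the `α` binary coordinates, which is a
binary linear code. -/
def punctureX {α β : ℕ} (C : AddSubgroup (Z2Z4 α β)) : Submodule (ZMod 2) (Fin α → ZMod 2) :=
  AddSubgroup.toZModSubmodule 2 (C.map (AddMonoidHom.fst (Fin α → ZMod 2) (Fin β → ZMod 4)))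

/-- `C` is a `ℤ₂ℤ₄`-additive code of type `(a, b; γ, δ; κ)`. -/
structure IsOfType {α β : ℕ} (C : AddSubgroup (Z2Z4 α β)) (a b γ δ κ : ℕ) : Prop where
  /-- The number of binary coordinates is `a`. -/
  binary_coords : α = a
  /-- The number of quaternary coordinates is `b`. -/
  quaternary_coords : β = b
  /-- As a group, `C` is isomorphic to `ℤ₂^γ × ℤ₄^δ`. -/
  group_type : Nonempty (C ≃+ (Fin γ → ZMod 2) × (Fin δ → ZMod 4))
  /-- The binary linear code `(C_b)_X` has dimension `κ`. -/
  dim_eq : Module.finrank (ZMod 2) (punctureX (orderTwoSubcode C)) = κ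

/-! Write `G` for the ambient group, `G[2]` for its 2-torsion, `2G` for its doubles, and `Q = G ⧸
C`. The type of a code `D` is determined by the orders of `D`, `D ∩ G[2]` and the binary projection
of `D ∩ G[2]`; the kernel of that projection is `D ∩ 2G`, so the proof only counts subgroups.

For a 1-perfect code, the errors of weight at most one (`0`, binary `e_i`, quaternary `±e_j`)
represent each coset exactly once. Hence `|Q| = α + 2β + 1 = 2^t`. Since `e_j` and `-e_j` lie in
different cosets, `Q[2]` consists of the classes of `0` and the `e_i`: it is the image of `G[2]` and
has order `α + 1 = 2^r`. Therefore `2Q`, the image of `2G`, has order `2^(t-r)`. Dividing the orders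
of `G`, `G[2]`, `2G` by those of their images in `Q` gives the orders of their intersections with
`C`.

For the dual, `|C^⊥| |C| = |G|`, while `2G` and `G[2]` are dual to each other. So `C^⊥ ∩ G[2]` and
`C^⊥ ∩ 2G` are the duals of `C + 2G` and `C + G[2]`, whose orders are again known from the images in
`Q`. The carrying lemmas are `isOfType_iff_card`, `card_dualCode_mul_card` and
`IsOnePerfect.map_twoTorsion`. -/

/-! ### Finite abelian groups of exponent dividing four. -/

theorem AddSubgroup.card_eq_card_inf_ker_mul_card_map {G H : Type*} [AddGroup G] [AddGroup H]
    (f : G →+ H) (N : AddSubgroup G) :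
    Nat.card N = Nat.card (N ⊓ f.ker : AddSubgroup G) * Nat.card (N.map f) := by
  rw [← AddSubgroup.relIndex_ker, ← AddSubgroup.inf_relIndex_left, ← AddSubgroup.relIndex_bot_left,
    ← AddSubgroup.relIndex_bot_left]
  exact (AddSubgroup.relIndex_mul_relIndex _ _ _ bot_le inf_le_left).symm

/-- A finite abelian group of exponent dividing four is a sum of copies of `ℤ₂` and `ℤ₄`. -/
theorem exists_addEquiv_of_four_nsmul {A : Type*} [AddCommGroup A] [Finite A]
    (h : ∀ x : A, 4 • x = 0) : ∃ γ δ : ℕ, Nonempty (A ≃+ Z2Z4 γ δ) := by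
  classical
  obtain ⟨ι, _, n, hn, ⟨e⟩⟩ := AddCommGroup.equiv_directSum_zmod_of_finite' A
  let e' : A ≃+ (∀ i, ZMod (n i)) := e.trans (DirectSum.addEquivProd _)
  have h4 : ∀ i, n i ∣ 4 := fun i => by
    have h0 : 4 • (Pi.single i 1 : ∀ i, ZMod (n i)) = 0 := by
      obtain ⟨x, hx⟩ := e'.surjective (Pi.single i 1)
      rw [← hx, ← map_nsmul, h, map_zero]
    have h1 := congrFun h0 i
    simp only [Pi.smul_apply, Pi.single_eq_same, Pi.zero_apply, nsmul_eq_mul, mul_one] at h1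
    exact (ZMod.natCast_eq_zero_iff 4 (n i)).1 h1
  -- The decomposition has `1 < n i`, so a divisor of 4 can only be 2 or 4.
  have hn' : ∀ i, n i ≠ 2 → n i = 4 := fun i hi => by
    have := hn i
    have h5 := Nat.le_of_dvd (by norm_num) (h4 i)
    have h6 := h4 i
    interval_cases n i <;> omega
  let e₁ := (Fintype.equivFin {i // n i = 2}).symm
  let e₂ := (Fintype.equivFin {i // n i ≠ 2}).symm
  let φ : (∀ i, ZMod (n i)) →+ Z2Z4 (Fintype.card {i // n i = 2}) (Fintype.card {i // n i ≠ 2}) :=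
    { toFun := fun f => (fun k => ZMod.ringEquivCongr (e₁ k).2 (f (e₁ k)),
        fun k => ZMod.ringEquivCongr (hn' _ (e₂ k).2) (f (e₂ k)))
      map_zero' := by ext <;> simp
      map_add' := fun f g => by ext <;> simp }
  refine ⟨_, _, ⟨e'.trans (AddEquiv.ofBijective φ ⟨?_, ?_⟩)⟩⟩
  · intro f g hfg
    funext i
    by_cases hi : n i = 2
    · have h1 := congrFun (congrArg Prod.fst hfg) (e₁.symm ⟨i, hi⟩)
      have h2 := (ZMod.ringEquivCongr _).injective h1
      rwa [e₁.apply_symm_apply] at h2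
    · have h1 := congrFun (congrArg Prod.snd hfg) (e₂.symm ⟨i, hi⟩)
      have h2 := (ZMod.ringEquivCongr _).injective h1
      rwa [e₂.apply_symm_apply] at h2
  · rintro ⟨u, w⟩
    refine ⟨fun i => if hi : n i = 2 then (ZMod.ringEquivCongr hi).symm (u (e₁.symm ⟨i, hi⟩))
      else (ZMod.ringEquivCongr (hn' i hi)).symm (w (e₂.symm ⟨i, hi⟩)), ?_⟩
    refine Prod.ext (funext fun k => ?_) (funext fun k => ?_)
    · simp [φ, (e₁ k).2]
    · simp [φ, (e₂ k).2]

/-- The subgroup of elements `x` with `2x = 0`. -/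
def twoTorsion (A : Type*) [AddCommGroup A] : AddSubgroup A := (nsmulAddMonoidHom (α := A) 2).ker

/-- The subgroup of elements of the form `2x`. -/
def doubles (A : Type*) [AddCommGroup A] : AddSubgroup A := (nsmulAddMonoidHom (α := A) 2).range

theorem mem_twoTorsion {A : Type*} [AddCommGroup A] {x : A} : x ∈ twoTorsion A ↔ 2 • x = 0 :=
  Iff.rfl

theorem mem_doubles {A : Type*} [AddCommGroup A] {x : A} : x ∈ doubles A ↔ ∃ y, 2 • y = x :=
  Iff.rfl

theorem card_twoTorsion_mul_card_doubles (A : Type*) [AddCommGroup A] :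
    Nat.card (twoTorsion A) * Nat.card (doubles A) = Nat.card A := by
  have h := AddSubgroup.card_eq_card_inf_ker_mul_card_map (nsmulAddMonoidHom (α := A) 2) ⊤
  rw [top_inf_eq, AddSubgroup.card_top, ← AddMonoidHom.range_eq_map] at h
  exact h.symm

theorem doubles_map_of_surjective {A B : Type*} [AddCommGroup A] [AddCommGroup B] (f : A →+ B)
    (hf : Function.Surjective f) : (doubles A).map f = doubles B := by
  ext x
  simp only [AddSubgroup.mem_map, mem_doubles]
  constructor
  · rintro ⟨_, ⟨y, rfl⟩, rfl⟩
    exact ⟨f y, (map_nsmul f 2 y).symm⟩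
  · rintro ⟨y, rfl⟩
    obtain ⟨z, rfl⟩ := hf y
    exact ⟨2 • z, ⟨z, rfl⟩, map_nsmul f 2 z⟩

/-! ### Torsion and doubles of the ambient group. -/

theorem card_Z2Z4 (α β : ℕ) : Nat.card (Z2Z4 α β) = 2 ^ (α + 2 * β) := by
  simp [pow_add, pow_mul]

theorem four_nsmul_Z2Z4 {α β : ℕ} (x : Z2Z4 α β) : 4 • x = 0 := by
  have h2 : ∀ a : ZMod 2, 4 • a = 0 := by decide
  have h4 : ∀ a : ZMod 4, 4 • a = 0 := by decide
  exact Prod.ext (funext fun i => h2 _) (funext fun j => h4 _)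

theorem card_twoTorsion_Z2Z4 (α β : ℕ) : Nat.card (twoTorsion (Z2Z4 α β)) = 2 ^ (α + β) := by
  have h2 : ∀ a : ZMod 2, 2 • a = 0 := by decide
  have h4 : ∀ a : ZMod 2, 2 • (2 * (a.val : ZMod 4)) = 0 := by decide
  have hinj : ∀ a b : ZMod 2, 2 * (a.val : ZMod 4) = 2 * (b.val : ZMod 4) → a = b := by decide
  have hsurj : ∀ y : ZMod 4, 2 • y = 0 → ∃ a : ZMod 2, 2 * (a.val : ZMod 4) = y := by decide
  let f : (Fin α → ZMod 2) × (Fin β → ZMod 2) → twoTorsion (Z2Z4 α β) := fun p =>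
    ⟨(p.1, fun j => 2 * ((p.2 j).val : ZMod 4)),
      mem_twoTorsion.2 (Prod.ext (funext fun i => h2 _) (funext fun j => h4 _))⟩
  have hf : Function.Bijective f := by
    constructor
    · rintro ⟨u, w⟩ ⟨u', w'⟩ h
      have h := congrArg Subtype.val h
      have h1 : u = u' := congrArg Prod.fst h
      exact Prod.ext h1 (funext fun j => hinj _ _ (congrFun (congrArg Prod.snd h) j))
    · rintro ⟨⟨u, w⟩, h⟩
      have hw : ∀ j, ∃ a : ZMod 2, 2 * (a.val : ZMod 4) = w j := fun j =>
        hsurj _ (congrFun (congrArg Prod.snd h) j)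
      choose w' hw' using hw
      exact ⟨(u, w'), Subtype.ext (Prod.ext rfl (funext hw'))⟩
  rw [← Nat.card_congr (Equiv.ofBijective f hf)]
  simp [pow_add]

theorem card_doubles_Z2Z4 (α β : ℕ) : Nat.card (doubles (Z2Z4 α β)) = 2 ^ β := by
  have h := card_twoTorsion_mul_card_doubles (Z2Z4 α β)
  rw [card_twoTorsion_Z2Z4, card_Z2Z4, two_mul, ← add_assoc, pow_add _ (α + β)] at h
  exact Nat.eq_of_mul_eq_mul_left (by positivity) h

/-- In `ℤ₄` both the 2-torsion and the doubles are `{0, 2}`; in `ℤ₂` every double vanishes. -/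
theorem twoTorsion_inf_ker_fst (α β : ℕ) :
    twoTorsion (Z2Z4 α β) ⊓ (AddMonoidHom.fst (Fin α → ZMod 2) (Fin β → ZMod 4)).ker =
      doubles (Z2Z4 α β) := by
  have h2 : ∀ a : ZMod 2, 2 • a = 0 := by decide
  have h4 : ∀ a : ZMod 4, 2 • 2 • a = 0 := by decide
  have hsurj : ∀ y : ZMod 4, 2 • y = 0 → ∃ a : ZMod 4, 2 • a = y := by decide
  ext x
  rw [AddSubgroup.mem_inf, mem_twoTorsion, mem_doubles, AddMonoidHom.mem_ker]
  constructor
  · rintro ⟨h, h1⟩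
    choose w hw using fun j => hsurj (x.2 j) (congrFun (congrArg Prod.snd h) j)
    exact ⟨(0, w), Prod.ext ((smul_zero 2).trans (show 0 = x.1 from h1.symm)) (funext hw)⟩
  · rintro ⟨y, rfl⟩
    exact ⟨Prod.ext (funext fun i => h2 _) (funext fun j => h4 _), funext fun i => h2 _⟩

theorem card_twoTorsion_congr {A B : Type*} [AddCommGroup A] [AddCommGroup B] (e : A ≃+ B) :
    Nat.card (twoTorsion A) = Nat.card (twoTorsion B) :=
  Nat.card_congr (e.toEquiv.subtypeEquiv fun x => by
    change 2 • x = 0 ↔ 2 • e x = 0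
    rw [← map_nsmul, EmbeddingLike.map_eq_zero_iff])

/-! ### The type of a code read off from cardinalities. -/

theorem orderTwoSubcode_eq {α β : ℕ} (C : AddSubgroup (Z2Z4 α β)) :
    orderTwoSubcode C = C ⊓ twoTorsion (Z2Z4 α β) := rfl

theorem card_orderTwoSubcode {α β : ℕ} (C : AddSubgroup (Z2Z4 α β)) :
    Nat.card (orderTwoSubcode C) = Nat.card (twoTorsion C) :=
  Nat.card_congr
    { toFun := fun x => ⟨⟨x.1, x.2.1⟩, Subtype.ext x.2.2⟩
      invFun := fun x => ⟨x.1.1, x.1.2, congrArg Subtype.val x.2⟩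
      left_inv := fun _ => rfl
      right_inv := fun _ => rfl }

/-- Some pair of exponents exists by the structure theorem, and the two orders determine `γ + 2δ`
and `γ + δ`, hence both exponents. -/
theorem nonempty_addEquiv_iff_card {A : Type*} [AddCommGroup A] [Finite A]
    (h : ∀ x : A, 4 • x = 0) (γ δ : ℕ) :
    Nonempty (A ≃+ Z2Z4 γ δ) ↔
      Nat.card A = 2 ^ (γ + 2 * δ) ∧ Nat.card (twoTorsion A) = 2 ^ (γ + δ) := by
  constructor
  · rintro ⟨e⟩
    exact ⟨(Nat.card_congr e.toEquiv).trans (card_Z2Z4 _ _),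
      (card_twoTorsion_congr e).trans (card_twoTorsion_Z2Z4 _ _)⟩
  · rintro ⟨h1, h2⟩
    obtain ⟨γ', δ', ⟨e⟩⟩ := exists_addEquiv_of_four_nsmul h
    rw [Nat.card_congr e.toEquiv, card_Z2Z4] at h1
    rw [card_twoTorsion_congr e, card_twoTorsion_Z2Z4] at h2
    have h1 := Nat.pow_right_injective le_rfl h1
    have h2 := Nat.pow_right_injective le_rfl h2
    obtain rfl : δ = δ' := by omega
    obtain rfl : γ = γ' := by omega
    exact ⟨e⟩

theorem isOfType_iff_card {α β : ℕ} (C : AddSubgroup (Z2Z4 α β)) (a b γ δ κ : ℕ) :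
    IsOfType C a b γ δ κ ↔ α = a ∧ β = b ∧ Nat.card C = 2 ^ (γ + 2 * δ) ∧
      Nat.card (orderTwoSubcode C) = 2 ^ (γ + δ) ∧
      Nat.card (punctureX (orderTwoSubcode C)) = 2 ^ κ := by
  have h4 : ∀ x : C, 4 • x = 0 := fun x => Subtype.ext (four_nsmul_Z2Z4 x.1)
  have hk : Module.finrank (ZMod 2) (punctureX (orderTwoSubcode C)) = κ ↔
      Nat.card (punctureX (orderTwoSubcode C)) = 2 ^ κ := by
    rw [Module.natCard_eq_pow_finrank (K := ZMod 2), Nat.card_zmod,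
      (Nat.pow_right_injective le_rfl).eq_iff]
  rw [card_orderTwoSubcode, ← hk, ← and_assoc (a := Nat.card C = _),
    ← nonempty_addEquiv_iff_card h4]
  exact ⟨fun h => ⟨h.1, h.2, h.3, h.4⟩, fun h => ⟨h.1, h.2.1, h.2.2.1, h.2.2.2⟩⟩

theorem card_orderTwoSubcode_eq_mul {α β : ℕ} (C : AddSubgroup (Z2Z4 α β)) :
    Nat.card (orderTwoSubcode C) =
      Nat.card (C ⊓ doubles (Z2Z4 α β) : AddSubgroup (Z2Z4 α β)) *
        Nat.card (punctureX (orderTwoSubcode C)) := by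
  have h := AddSubgroup.card_eq_card_inf_ker_mul_card_map
    (AddMonoidHom.fst (Fin α → ZMod 2) (Fin β → ZMod 4)) (orderTwoSubcode C)
  rwa [orderTwoSubcode_eq, inf_assoc, twoTorsion_inf_ker_fst] at h

/-! ### Duality. -/

theorem innerZ4_comm {α β : ℕ} (u v : Z2Z4 α β) : innerZ4 u v = innerZ4 v u := by
  simp only [innerZ4, mul_comm]

theorem innerZ4_add_left {α β : ℕ} (u v w : Z2Z4 α β) :
    innerZ4 (u + v) w = innerZ4 u w + innerZ4 v w := by
  rw [innerZ4_comm, innerZ4_add_right, innerZ4_comm w, innerZ4_comm w]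

/-- The inner product as a bilinear pairing. -/
def innerHom (α β : ℕ) : Z2Z4 α β →+ (Z2Z4 α β →+ ZMod 4) :=
  AddMonoidHom.mk' (fun v => AddMonoidHom.mk' (fun u => innerZ4 u v)
    fun u u' => innerZ4_add_left u u' v) fun v w => by
      ext1 u
      exact innerZ4_add_right u v w

theorem innerHom_apply {α β : ℕ} (u v : Z2Z4 α β) : innerHom α β v u = innerZ4 u v := rfl

theorem innerZ4_single_fst {α β : ℕ} (i : Fin α) (v : Z2Z4 α β) :
    innerZ4 ((Pi.single i 1, 0) : Z2Z4 α β) v = 2 * ((v.1 i).val : ZMod 4) := by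
  rw [innerZ4, add_eq_left.2 (by simp)]
  have h : ∀ k, (((Pi.single i 1 : Fin α → ZMod 2) k).val : ZMod 4) * ((v.1 k).val : ZMod 4) =
      if k = i then ((v.1 k).val : ZMod 4) else 0 := fun k => by
    by_cases hk : k = i
    · subst hk
      simp [show (1 : ZMod 2).val = 1 from rfl]
    · simp [hk]
  rw [Finset.sum_congr rfl fun k _ => h k, Finset.sum_ite_eq' Finset.univ i, if_pos (Finset.mem_univ i)]

theorem innerZ4_single_snd {α β : ℕ} (j : Fin β) (v : Z2Z4 α β) :
    innerZ4 ((0, Pi.single j 1) : Z2Z4 α β) v = v.2 j := by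
  simp [innerZ4, Pi.single_apply]

/-- Homomorphisms out of `ℤ₂^α × ℤ₄^β` are determined by the standard generators. -/
theorem Z2Z4.hom_ext {α β : ℕ} {f g : Z2Z4 α β →+ ZMod 4}
    (h1 : ∀ i, f (Pi.single i 1, 0) = g (Pi.single i 1, 0))
    (h2 : ∀ j, f (0, Pi.single j 1) = g (0, Pi.single j 1)) : f = g := by
  have e1 : f.comp (AddMonoidHom.inl _ _) = g.comp (AddMonoidHom.inl _ _) := by
    refine AddMonoidHom.functions_ext _ _ _ fun i x => ?_
    have hx : (Pi.single i x : Fin α → ZMod 2) = x.val • Pi.single i 1 := by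
      rw [← Pi.single_smul]
      simp
    rw [hx, map_nsmul, map_nsmul]
    exact congrArg _ (h1 i)
  have e2 : f.comp (AddMonoidHom.inr _ _) = g.comp (AddMonoidHom.inr _ _) := by
    refine AddMonoidHom.functions_ext _ _ _ fun i x => ?_
    have hx : (Pi.single i x : Fin β → ZMod 4) = x.val • Pi.single i 1 := by
      rw [← Pi.single_smul]
      simp
    rw [hx, map_nsmul, map_nsmul]
    exact congrArg _ (h2 i)
  rw [← AddMonoidHom.coprod_unique f, ← AddMonoidHom.coprod_unique g, e1, e2]

/-- A character is fixed by its values on the generators: these are arbitrary on quaternary ones and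
lie in `{0, 2}` on binary ones, which are exactly the values the pairing produces. -/
theorem innerHom_bijective (α β : ℕ) : Function.Bijective (innerHom α β) := by
  have hinj : ∀ a b : ZMod 2, 2 * (a.val : ZMod 4) = 2 * (b.val : ZMod 4) → a = b := by decide
  have hsurj : ∀ y : ZMod 4, 2 • y = 0 → ∃ a : ZMod 2, 2 * (a.val : ZMod 4) = y := by decide
  constructor
  · intro v w h
    have h' : ∀ u, innerZ4 u v = innerZ4 u w := fun u => DFunLike.congr_fun h u
    refine Prod.ext (funext fun i => hinj _ _ ?_) (funext fun j => ?_)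
    · rw [← innerZ4_single_fst, h', innerZ4_single_fst]
    · rw [← innerZ4_single_snd, h', innerZ4_single_snd]
  · intro f
    have h : ∀ i, 2 • f (Pi.single i 1, 0) = 0 := fun i => by
      have h2 : ∀ a : ZMod 2, 2 • a = 0 := by decide
      rw [← map_nsmul, show 2 • ((Pi.single i 1, 0) : Z2Z4 α β) = 0 from
        Prod.ext (funext fun i => h2 _) (smul_zero 2), map_zero]
    choose v hv using fun i => hsurj _ (h i)
    refine ⟨(v, fun j => f (0, Pi.single j 1)), Z2Z4.hom_ext (fun i => ?_) fun j => ?_⟩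
    · rw [innerHom_apply, innerZ4_single_fst, hv]
    · rw [innerHom_apply, innerZ4_single_snd]

/-- A finite abelian group of exponent dividing four has as many `ℤ₄`-valued characters as
elements. -/
theorem card_addMonoidHom_zmod_four {A : Type*} [AddCommGroup A] [Finite A]
    (h : ∀ x : A, 4 • x = 0) : Nat.card (A →+ ZMod 4) = Nat.card A := by
  obtain ⟨γ, δ, ⟨e⟩⟩ := exists_addEquiv_of_four_nsmul h
  rw [Nat.card_congr e.toEquiv, Nat.card_congr (Equiv.ofBijective _ (innerHom_bijective γ δ))]
  exact Nat.card_congr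
    { toFun := fun f => f.comp e.symm.toAddMonoidHom
      invFun := fun f => f.comp e.toAddMonoidHom
      left_inv := fun f => by ext; simp
      right_inv := fun f => by ext1; simp }

theorem mem_dualCode {α β : ℕ} {C : AddSubgroup (Z2Z4 α β)} {v : Z2Z4 α β} :
    v ∈ dualCode C ↔ ∀ u ∈ C, innerZ4 u v = 0 := Iff.rfl

/-- The dual code is the group of `ℤ₄`-valued characters of the quotient by `C`, which has as many
elements as the quotient. -/
theorem card_dualCode_mul_card {α β : ℕ} (C : AddSubgroup (Z2Z4 α β)) :
    Nat.card (dualCode C) * Nat.card C = 2 ^ (α + 2 * β) := by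
  have h4 : ∀ x : Z2Z4 α β ⧸ C, 4 • x = 0 := fun x => by
    obtain ⟨y, rfl⟩ := QuotientAddGroup.mk'_surjective C x
    rw [← map_nsmul, four_nsmul_Z2Z4, map_zero]
  let φ : dualCode C → (Z2Z4 α β ⧸ C →+ ZMod 4) := fun v =>
    QuotientAddGroup.lift C (innerHom α β v.1) fun u hu => v.2 u hu
  have hφ : Function.Bijective φ := by
    constructor
    · intro v w h
      refine Subtype.ext ((innerHom_bijective α β).1 ?_)
      ext1 u
      exact DFunLike.congr_fun h (QuotientAddGroup.mk' C u)
    · intro f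
      obtain ⟨v, hv⟩ := (innerHom_bijective α β).2 (f.comp (QuotientAddGroup.mk' C))
      refine ⟨⟨v, fun u hu => ?_⟩, ?_⟩
      · rw [← innerHom_apply, hv, AddMonoidHom.comp_apply, QuotientAddGroup.mk'_apply,
          (QuotientAddGroup.eq_zero_iff u).2 hu, map_zero]
      · ext u
        exact DFunLike.congr_fun hv u
  rw [Nat.card_congr (Equiv.ofBijective φ hφ), card_addMonoidHom_zmod_four h4,
    ← AddSubgroup.card_eq_card_quotient_mul_card_addSubgroup, card_Z2Z4]

theorem dualCode_sup {α β : ℕ} (C D : AddSubgroup (Z2Z4 α β)) :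
    dualCode (C ⊔ D) = dualCode C ⊓ dualCode D := by
  ext v
  rw [AddSubgroup.mem_inf, mem_dualCode, mem_dualCode, mem_dualCode]
  constructor
  · exact fun h => ⟨fun u hu => h u (AddSubgroup.mem_sup_left hu),
      fun u hu => h u (AddSubgroup.mem_sup_right hu)⟩
  · rintro ⟨h1, h2⟩ u hu
    obtain ⟨x, hx, y, hy, rfl⟩ := AddSubgroup.mem_sup.1 hu
    rw [innerZ4_add_left, h1 x hx, h2 y hy, add_zero]

/-- The factor 2 moves across the pairing, and the pairing is nondegenerate. -/
theorem dualCode_doubles (α β : ℕ) :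
    dualCode (doubles (Z2Z4 α β)) = twoTorsion (Z2Z4 α β) := by
  ext v
  rw [mem_dualCode, mem_twoTorsion]
  have h : ∀ u, innerZ4 (2 • u) v = innerHom α β (2 • v) u := fun u => by
    rw [innerHom_apply, two_nsmul, two_nsmul, innerZ4_add_left, innerZ4_add_right]
  constructor
  · intro hv
    refine (injective_iff_map_eq_zero (innerHom α β)).1 (innerHom_bijective α β).1 _ ?_
    ext1 u
    exact (h u).symm.trans (hv _ ⟨u, rfl⟩)
  · rintro hv _ ⟨u, rfl⟩
    exact (h u).trans (by rw [hv, map_zero]; rfl)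

/-- Moving the factor 2 across gives one inclusion; equality follows by counting. -/
theorem dualCode_twoTorsion (α β : ℕ) :
    dualCode (twoTorsion (Z2Z4 α β)) = doubles (Z2Z4 α β) := by
  refine (AddSubgroup.eq_of_le_of_card_ge ?_ ?_).symm
  · rintro _ ⟨v, rfl⟩ u hu
    have hu' : u + u = 0 := (two_nsmul u).symm.trans hu
    have h : innerZ4 u (v + v) = 0 := by
      rw [innerZ4_add_right, ← innerZ4_add_left, hu', innerZ4_comm, innerZ4_zero_right]
    exact (congrArg (innerZ4 u) (two_nsmul v)).trans h
  · have h := card_dualCode_mul_card (twoTorsion (Z2Z4 α β))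
    rw [card_twoTorsion_Z2Z4] at h
    rw [card_doubles_Z2Z4]
    have h' := h.trans (show 2 ^ (α + 2 * β) = 2 ^ β * 2 ^ (α + β) by ring)
    exact (Nat.eq_of_mul_eq_mul_right (by positivity) h').le

/-! ### Lee weight and the Gray isometry. -/

/-- The Lee weight of an element of `ℤ₄`. -/
def leeDigit (a : ZMod 4) : ℕ := if a = 0 then 0 else if a = 2 then 2 else 1

/-- The Lee weight on `ℤ₂^α × ℤ₄^β`: Hamming weight on the binary coordinates, Lee weight on the
quaternary ones. -/
def leeWeight {α β : ℕ} (w : Z2Z4 α β) : ℕ :=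
  ∑ i, (if w.1 i = 0 then 0 else 1) + ∑ j, leeDigit (w.2 j)

theorem hammingDist_grayMap {α β : ℕ} (u v : Z2Z4 α β) :
    hammingDist (grayMap u) (grayMap v) = leeWeight (u - v) := by
  have hd : ∀ a b : ZMod 4, ((if grayDigit a 0 ≠ grayDigit b 0 then 1 else 0) +
      if grayDigit a 1 ≠ grayDigit b 1 then 1 else 0) = leeDigit (a - b) := by decide
  have hb : ∀ a b : ZMod 2, (if a ≠ b then 1 else 0) = if a - b = 0 then 0 else 1 := by decide
  rw [hammingDist, Finset.card_filter, Fintype.sum_sum_type, Fintype.sum_prod_type, leeWeight]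
  refine congrArg₂ (· + ·) (Finset.sum_congr rfl fun i _ => ?_) (Finset.sum_congr rfl fun j _ => ?_)
  · convert hb (u.1 i) (v.1 i) <;> rfl
  · rw [Fin.sum_univ_two]
    convert hd (u.2 j) (v.2 j) <;> rfl

theorem grayMap_injective {α β : ℕ} : Function.Injective (grayMap (α := α) (β := β)) := by
  have hd : ∀ a b : ZMod 4, grayDigit a 0 = grayDigit b 0 → grayDigit a 1 = grayDigit b 1 →
      a = b := by decide
  intro u v h
  exact Prod.ext (funext fun i => congrFun h (Sum.inl i))
    (funext fun j => hd _ _ (congrFun h (Sum.inr (j, 0))) (congrFun h (Sum.inr (j, 1))))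

theorem grayMap_surjective {α β : ℕ} : Function.Surjective (grayMap (α := α) (β := β)) := by
  have hd : ∀ b c : ZMod 2, ∃ a : ZMod 4, grayDigit a 0 = b ∧ grayDigit a 1 = c := by decide
  intro x
  choose w hw using fun j => hd (x (Sum.inr (j, 0))) (x (Sum.inr (j, 1)))
  refine ⟨(fun i => x (Sum.inl i), w), funext ?_⟩
  rintro (i | ⟨j, k⟩)
  · rfl
  · fin_cases k
    · exact (hw j).1
    · exact (hw j).2

theorem isOnePerfect_iff {α β : ℕ} (C : AddSubgroup (Z2Z4 α β)) :
    IsOnePerfect C ↔ ∀ v : Z2Z4 α β, ∃! c, c ∈ C ∧ leeWeight (v - c) ≤ 1 := by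
  rw [IsOnePerfect, IsBinaryOnePerfect, grayMap_surjective.forall]
  refine forall_congr' fun v => ⟨?_, ?_⟩
  · rintro ⟨_, ⟨⟨c, hc, rfl⟩, hd⟩, huniq⟩
    rw [hammingDist_grayMap] at hd
    refine ⟨c, ⟨hc, hd⟩, fun c' hc' => grayMap_injective (huniq _ ⟨⟨c', hc'.1, rfl⟩, ?_⟩)⟩
    rw [hammingDist_grayMap]
    exact hc'.2
  · rintro ⟨c, ⟨hc, hd⟩, huniq⟩
    refine ⟨grayMap c, ⟨⟨c, hc, rfl⟩, by rwa [hammingDist_grayMap]⟩, ?_⟩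
    rintro _ ⟨⟨c', hc', rfl⟩, hd'⟩
    rw [hammingDist_grayMap] at hd'
    rw [huniq c' ⟨hc', hd'⟩]

/-! ### Syndromes of a 1-perfect code. -/

/-- The error patterns of Lee weight at most one. -/
def errorPattern {α β : ℕ} : Option (Fin α ⊕ (Fin β ⊕ Fin β)) → Z2Z4 α β
  | none => 0
  | some (Sum.inl i) => (Pi.single i 1, 0)
  | some (Sum.inr (Sum.inl j)) => (0, Pi.single j 1)
  | some (Sum.inr (Sum.inr j)) => (0, Pi.single j (-1))

theorem Pi.eq_and_eq_of_single_eq_single {ι R : Type*} [DecidableEq ι] [Zero R] {i j : ι} {a b : R}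
    (ha : a ≠ 0) (h : (Pi.single i a : ι → R) = Pi.single j b) : i = j ∧ a = b := by
  have h' := congrFun h i
  rw [Pi.single_eq_same, Pi.single_apply] at h'
  split_ifs at h' with hij
  · exact ⟨hij, h'⟩
  · exact absurd h' ha

theorem errorPattern_injective {α β : ℕ} :
    Function.Injective (errorPattern (α := α) (β := β)) := by
  have h1 : (1 : ZMod 4) ≠ -1 := by decide
  have h10 : (1 : ZMod 4) ≠ 0 := by decide
  have h0 : (-1 : ZMod 4) ≠ 0 := by decide
  rintro (_ | i | j | j) (_ | i' | j' | j') h <;>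
    have hX := congrArg Prod.fst h <;> have hY := congrArg Prod.snd h <;>
    simp only [errorPattern, Prod.fst_zero, Prod.snd_zero] at hX hY
  · rfl
  · exact absurd hX.symm (Pi.single_ne_zero_iff.2 one_ne_zero)
  · exact absurd hY.symm (Pi.single_ne_zero_iff.2 h10)
  · exact absurd hY.symm (Pi.single_ne_zero_iff.2 h0)
  · exact absurd hX (Pi.single_ne_zero_iff.2 one_ne_zero)
  · rw [(Pi.eq_and_eq_of_single_eq_single one_ne_zero hX).1]
  · exact absurd hX (Pi.single_ne_zero_iff.2 one_ne_zero)
  · exact absurd hX (Pi.single_ne_zero_iff.2 one_ne_zero)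
  · exact absurd hY (Pi.single_ne_zero_iff.2 h10)
  · exact absurd hX.symm (Pi.single_ne_zero_iff.2 one_ne_zero)
  · rw [(Pi.eq_and_eq_of_single_eq_single h10 hY).1]
  · exact absurd (Pi.eq_and_eq_of_single_eq_single h10 hY).2 h1
  · exact absurd hY (Pi.single_ne_zero_iff.2 h0)
  · exact absurd hX.symm (Pi.single_ne_zero_iff.2 one_ne_zero)
  · exact absurd (Pi.eq_and_eq_of_single_eq_single h0 hY).2 h1.symm
  · rw [(Pi.eq_and_eq_of_single_eq_single h0 hY).1]

theorem leeWeight_errorPattern_le {α β : ℕ} (x : Option (Fin α ⊕ (Fin β ⊕ Fin β))) :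
    leeWeight (errorPattern x) ≤ 1 := by
  have hl : ∀ (j k : Fin β) (c : ZMod 4), leeDigit c = 1 →
      leeDigit ((Pi.single j c : Fin β → ZMod 4) k) = if k = j then 1 else 0 := fun j k c hc => by
    by_cases hk : k = j
    · subst hk; simp [hc]
    · simp [hk, leeDigit]
  have h0 : leeDigit 0 = 0 := rfl
  obtain _ | i | j | j := x
  · simp [leeWeight, errorPattern, h0]
  · simp only [leeWeight, errorPattern, Pi.zero_apply, h0, Finset.sum_const_zero, add_zero]
    rw [Finset.sum_eq_single i (fun k _ hk => by simp [hk]) (by simp)]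
    simp
  · simp [leeWeight, errorPattern, hl j _ 1 rfl]
  · simp [leeWeight, errorPattern, hl j _ (-1) rfl]

theorem exists_errorPattern_eq {α β : ℕ} (w : Z2Z4 α β) (hw : leeWeight w ≤ 1) :
    ∃ x, errorPattern x = w := by
  have hd0 : ∀ a : ZMod 4, leeDigit a = 0 → a = 0 := by decide
  have hd1 : ∀ a : ZMod 4, leeDigit a = 1 → a = 1 ∨ a = -1 := by decide
  have hb1 : ∀ a : ZMod 2, a ≠ 0 → a = 1 := by decide
  by_cases h1 : ∃ i, w.1 i ≠ 0
  · obtain ⟨i, hi⟩ := h1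
    have hs := Finset.add_sum_erase Finset.univ (fun i => if w.1 i = 0 then 0 else 1)
      (Finset.mem_univ i)
    simp only [hi, if_false] at hs
    rw [leeWeight, ← hs] at hw
    have ha : ∑ k ∈ Finset.univ.erase i, (if w.1 k = 0 then 0 else 1) = 0 := by omega
    have hb : ∑ j, leeDigit (w.2 j) = 0 := by omega
    rw [Finset.sum_eq_zero_iff] at ha hb
    refine ⟨some (Sum.inl i), Prod.ext (funext fun k => ?_) (funext fun j => ?_)⟩
    · by_cases hk : k = i
      · subst hk
        simp [errorPattern, hb1 _ hi]
      · have := ha k (by simp [hk])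
        by_contra hne
        simp [errorPattern, hk] at hne this
        exact hne this.symm
    · exact (hd0 _ (hb j (Finset.mem_univ j))).symm
  · push Not at h1
    have hw1 : w.1 = 0 := funext h1
    by_cases h2 : ∃ j, w.2 j ≠ 0
    · obtain ⟨j, hj⟩ := h2
      have hs := Finset.add_sum_erase Finset.univ (fun j => leeDigit (w.2 j)) (Finset.mem_univ j)
      have hj0 : leeDigit (w.2 j) ≠ 0 := fun h => hj (hd0 _ h)
      rw [leeWeight, ← hs] at hw
      have ha : ∑ k ∈ Finset.univ.erase j, leeDigit (w.2 k) = 0 := by omega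
      have hj1 : leeDigit (w.2 j) = 1 := by omega
      rw [Finset.sum_eq_zero_iff] at ha
      have hsing : w.2 = Pi.single j (w.2 j) := funext fun k => by
        by_cases hk : k = j
        · subst hk
          simp
        · simp [hk, hd0 _ (ha k (by simp [hk]))]
      rcases hd1 _ hj1 with h | h
      · exact ⟨some (Sum.inr (Sum.inl j)), Prod.ext hw1.symm (by rw [hsing, h]; rfl)⟩
      · exact ⟨some (Sum.inr (Sum.inr j)), Prod.ext hw1.symm (by rw [hsing, h]; rfl)⟩
    · push Not at h2
      exact ⟨none, Prod.ext hw1.symm (funext fun j => (h2 j).symm)⟩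

/-- The syndromes of the error patterns of weight at most one are all the cosets of a 1-perfect
code, each occurring once. -/
theorem IsOnePerfect.bijective_mk_errorPattern {α β : ℕ} {C : AddSubgroup (Z2Z4 α β)}
    (hC : IsOnePerfect C) :
    Function.Bijective fun x => QuotientAddGroup.mk' C (errorPattern x) := by
  rw [isOnePerfect_iff] at hC
  constructor
  · intro x y h
    refine errorPattern_injective ?_
    have hmem : errorPattern x - errorPattern y ∈ C := by
      rw [← QuotientAddGroup.ker_mk' C, AddMonoidHom.mem_ker, map_sub, sub_eq_zero]
      exact h
    have := (hC (errorPattern x)).unique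
      ⟨hmem, by rw [sub_sub_cancel]; exact leeWeight_errorPattern_le y⟩
      ⟨C.zero_mem, by rw [sub_zero]; exact leeWeight_errorPattern_le x⟩
    exact sub_eq_zero.1 this
  · intro q
    obtain ⟨v, rfl⟩ := QuotientAddGroup.mk'_surjective C q
    obtain ⟨c, ⟨hc, hd⟩, -⟩ := hC v
    obtain ⟨x, hx⟩ := exists_errorPattern_eq _ hd
    refine ⟨x, ?_⟩
    have h0 : QuotientAddGroup.mk' C c = 0 := (QuotientAddGroup.eq_zero_iff c).2 hc
    simp only [hx, map_sub, h0, sub_zero]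

theorem IsOnePerfect.card_quotient {α β : ℕ} {C : AddSubgroup (Z2Z4 α β)} (hC : IsOnePerfect C) :
    Nat.card (Z2Z4 α β ⧸ C) = α + 2 * β + 1 := by
  rw [← Nat.card_congr (Equiv.ofBijective _ hC.bijective_mk_errorPattern)]
  simp
  omega

/-- A 2-torsion coset equals its negative, which excludes the classes of `±e_j` and leaves those of
`0` and the binary `e_i`. -/
theorem IsOnePerfect.map_twoTorsion {α β : ℕ} {C : AddSubgroup (Z2Z4 α β)}
    (hC : IsOnePerfect C) :
    (twoTorsion (Z2Z4 α β)).map (QuotientAddGroup.mk' C) = twoTorsion (Z2Z4 α β ⧸ C) ∧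
      Nat.card (twoTorsion (Z2Z4 α β ⧸ C)) = α + 1 := by
  have hbin : ∀ a : ZMod 2, 2 • a = 0 := by decide
  let g : Option (Fin α) → Option (Fin α ⊕ (Fin β ⊕ Fin β)) := Option.map Sum.inl
  have hg : ∀ x, errorPattern (g x) ∈ twoTorsion (Z2Z4 α β) := by
    rintro (_ | i)
    · exact zero_mem _
    · exact mem_twoTorsion.2 (Prod.ext (funext fun k => hbin _) (smul_zero 2))
  have hmap : ∀ v ∈ twoTorsion (Z2Z4 α β),
      QuotientAddGroup.mk' C v ∈ twoTorsion (Z2Z4 α β ⧸ C) := fun v hv => by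
    rw [mem_twoTorsion, ← map_nsmul, mem_twoTorsion.1 hv, map_zero]
  have hsurj : ∀ q ∈ twoTorsion (Z2Z4 α β ⧸ C),
      ∃ x, QuotientAddGroup.mk' C (errorPattern (g x)) = q := by
    intro q hq
    have hneg : -q = q := by
      rw [neg_eq_iff_add_eq_zero, ← two_nsmul]
      exact hq
    obtain ⟨x, rfl⟩ := hC.bijective_mk_errorPattern.2 q
    obtain _ | i | j | j := x
    · exact ⟨none, rfl⟩
    · exact ⟨some i, rfl⟩
    -- `e_j` and `-e_j` would share a syndrome, against injectivity.
    · have := hC.bijective_mk_errorPattern.1 (a₁ := some (Sum.inr (Sum.inr j)))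
        (a₂ := some (Sum.inr (Sum.inl j))) (by
          simp only [← map_neg] at hneg ⊢
          rw [← hneg]
          simp [errorPattern, ← Pi.single_neg])
      simp at this
    · have := hC.bijective_mk_errorPattern.1 (a₁ := some (Sum.inr (Sum.inl j)))
        (a₂ := some (Sum.inr (Sum.inr j))) (by
          simp only [← map_neg] at hneg ⊢
          rw [← hneg]
          simp [errorPattern, ← Pi.single_neg])
      simp at this
  constructor
  · refine le_antisymm ?_ fun q hq => ?_
    · rintro _ ⟨v, hv, rfl⟩
      exact hmap v hv
    · obtain ⟨x, rfl⟩ := hsurj q hq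
      exact ⟨_, hg x, rfl⟩
  · let f : Option (Fin α) → twoTorsion (Z2Z4 α β ⧸ C) := fun x => ⟨_, hmap _ (hg x)⟩
    have hf : Function.Bijective f :=
      ⟨fun x y h => Option.map_injective Sum.inl_injective
        (hC.bijective_mk_errorPattern.1 (congrArg Subtype.val h)),
      fun ⟨q, hq⟩ => (hsurj q hq).imp fun x hx => Subtype.ext hx⟩
    rw [← Nat.card_congr (Equiv.ofBijective f hf)]
    simp

/-! ### The final count. -/

theorem card_sup_eq {G : Type*} [AddCommGroup G] (C N : AddSubgroup G) :
    Nat.card (C ⊔ N : AddSubgroup G) =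
      Nat.card C * Nat.card (N.map (QuotientAddGroup.mk' C)) := by
  have h := AddSubgroup.card_eq_card_inf_ker_mul_card_map (QuotientAddGroup.mk' C) (C ⊔ N)
  have h0 : C.map (QuotientAddGroup.mk' C) = ⊥ :=
    (AddSubgroup.map_eq_bot_iff C).2 (QuotientAddGroup.ker_mk' C).ge
  rwa [AddSubgroup.map_sup, QuotientAddGroup.ker_mk', h0, bot_sup_eq,
    inf_eq_right.2 le_sup_left] at h

theorem eq_two_pow_iff_of_mul_eq {x a b n : ℕ} (h : x * 2 ^ a = 2 ^ b) :
    x = 2 ^ n ↔ n + a = b := by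
  rw [← (Nat.pow_right_injective le_rfl).eq_iff (a := n + a), pow_add, ← h]
  exact eq_comm.trans ((Nat.mul_left_inj (pow_ne_zero a two_ne_zero)).symm)

theorem proposition2p3 (r t : ℕ) (hr : 2 ≤ r) (hrt : r ≤ t) (htr : t ≤ 2 * r)
    (α β : ℕ) (hα : α = 2 ^ r - 1) (hlen : α + 2 * β = 2 ^ t - 1)
    (C : AddSubgroup (Z2Z4 α β)) (hC : IsOnePerfect C) :
    (∀ a b γ δ κ : ℕ, IsOfType C a b γ δ κ ↔
      ((a : ℤ) = 2 ^ r - 1 ∧ (b : ℤ) = 2 ^ (t - 1) - 2 ^ (r - 1) ∧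
        (γ : ℤ) = 2 ^ r - 1 - 2 * r + t ∧
        (δ : ℤ) = 2 ^ (t - 1) - 2 ^ (r - 1) + r - t ∧
        κ = γ)) ∧
    (∀ a b γ δ κ : ℕ, IsOfType (dualCode C) a b γ δ κ ↔
      (a = α ∧ b = β ∧ (γ : ℤ) = 2 * r - t ∧ (δ : ℤ) = t - r ∧ κ = γ)) := by
  have hα1 : α + 1 = 2 ^ r := by have := Nat.one_le_two_pow (n := r); omega
  have hlen1 : α + 2 * β + 1 = 2 ^ t := by have := Nat.one_le_two_pow (n := t); omega
  -- Here `s = t - r` is the exponent of the order of `2Q`.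
  obtain ⟨s, rfl⟩ := Nat.exists_eq_add_of_le hrt
  obtain ⟨hmap, hcardT⟩ := hC.map_twoTorsion
  have hcardQ := hC.card_quotient
  rw [hα1] at hcardT
  rw [hlen1] at hcardQ
  have hcardD : Nat.card (doubles (Z2Z4 α β ⧸ C)) = 2 ^ s := by
    have h := card_twoTorsion_mul_card_doubles (Z2Z4 α β ⧸ C)
    rw [hcardT, hcardQ, pow_add] at h
    exact Nat.eq_of_mul_eq_mul_left (by positivity) h
  have hmapD := doubles_map_of_surjective _ (QuotientAddGroup.mk'_surjective C)
  have hCcard : Nat.card C * 2 ^ (r + s) = 2 ^ (α + 2 * β) := by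
    rw [← card_Z2Z4, AddSubgroup.card_eq_card_quotient_mul_card_addSubgroup C, hcardQ, mul_comm]
  have hCT : Nat.card (orderTwoSubcode C) * 2 ^ r = 2 ^ (α + β) := by
    have h := AddSubgroup.card_eq_card_inf_ker_mul_card_map (QuotientAddGroup.mk' C)
      (twoTorsion (Z2Z4 α β))
    rw [hmap, hcardT, card_twoTorsion_Z2Z4, QuotientAddGroup.ker_mk', inf_comm] at h
    exact h.symm
  have hCD : Nat.card (C ⊓ doubles (Z2Z4 α β) : AddSubgroup (Z2Z4 α β)) * 2 ^ s = 2 ^ β := by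
    have h := AddSubgroup.card_eq_card_inf_ker_mul_card_map (QuotientAddGroup.mk' C)
      (doubles (Z2Z4 α β))
    rw [hmapD, hcardD, card_doubles_Z2Z4, QuotientAddGroup.ker_mk', inf_comm] at h
    exact h.symm
  have hCP : Nat.card (punctureX (orderTwoSubcode C)) * 2 ^ (β + r) = 2 ^ (α + β + s) := by
    rw [pow_add, pow_add _ (α + β), ← hCD, ← hCT, card_orderTwoSubcode_eq_mul]
    ring
  -- The factor `2 ^ 0` matches the shape required by `eq_two_pow_iff_of_mul_eq`.
  have hdual : Nat.card (dualCode C) * 2 ^ 0 = 2 ^ (r + s) := by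
    have h := card_dualCode_mul_card C
    rw [← hCcard, mul_comm] at h
    rw [pow_zero, mul_one]
    exact Nat.eq_of_mul_eq_mul_left Nat.card_pos h
  -- `C^⊥ ∩ G[2]` is the dual of `C + 2G`.
  have hdualT : Nat.card (orderTwoSubcode (dualCode C)) * 2 ^ 0 = 2 ^ r := by
    have h := card_dualCode_mul_card (C ⊔ doubles (Z2Z4 α β))
    rw [card_sup_eq, hmapD, hcardD, dualCode_sup, dualCode_doubles, ← orderTwoSubcode_eq,
      ← hCcard, pow_add, mul_left_comm, mul_right_inj' Nat.card_pos.ne'] at h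
    rw [pow_zero, mul_one]
    exact Nat.eq_of_mul_eq_mul_right (by positivity) h
  -- `C^⊥ ∩ 2G` is the dual of `C + G[2]`.
  have hdualD : Nat.card (dualCode C ⊓ doubles (Z2Z4 α β) : AddSubgroup (Z2Z4 α β)) = 2 ^ s := by
    have h := card_dualCode_mul_card (C ⊔ twoTorsion (Z2Z4 α β))
    rw [card_sup_eq, hmap, hcardT, dualCode_sup, dualCode_twoTorsion,
      ← hCcard, pow_add, mul_left_comm, mul_right_inj' Nat.card_pos.ne', mul_comm] at h
    exact Nat.eq_of_mul_eq_mul_left (by positivity) h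
  have hdualP : Nat.card (punctureX (orderTwoSubcode (dualCode C))) * 2 ^ s = 2 ^ r := by
    rw [← hdualT, card_orderTwoSubcode_eq_mul, hdualD, pow_zero, mul_one, mul_comm]
  have hr2 : (2 : ℤ) ^ r = 2 * 2 ^ (r - 1) := by
    rw [← pow_succ', Nat.sub_add_cancel (by omega)]
  have ht2 : (2 : ℤ) ^ (r + s) = 2 * 2 ^ (r + s - 1) := by
    rw [← pow_succ', Nat.sub_add_cancel (by omega)]
  have hαz : (α : ℤ) + 1 = 2 ^ r := by exact_mod_cast hα1
  have hlenz : (α : ℤ) + 2 * β + 1 = 2 ^ (r + s) := by exact_mod_cast hlen1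
  clear hrt hlen hlen1 hα hα1
  -- With the powers as atoms, only linear relations between exponents remain.
  generalize (2 : ℤ) ^ r = R at *
  generalize (2 : ℤ) ^ (r + s) = S at *
  generalize (2 : ℤ) ^ (r - 1) = R' at *
  generalize (2 : ℤ) ^ (r + s - 1) = T' at *
  constructor
  · intro a b γ δ κ
    rw [isOfType_iff_card, eq_two_pow_iff_of_mul_eq hCcard, eq_two_pow_iff_of_mul_eq hCT,
      eq_two_pow_iff_of_mul_eq hCP]
    clear hCcard hCT hCP hCD hdual hdualT hdualD hdualP hcardT hcardQ hcardD
    push_cast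
    constructor
    · rintro ⟨h1, h2, h3, h4, h5⟩
      omega
    · rintro ⟨h1, h2, h3, h4, h5⟩
      omega
  · intro a b γ δ κ
    rw [isOfType_iff_card, eq_two_pow_iff_of_mul_eq hdual, eq_two_pow_iff_of_mul_eq hdualT,
      eq_two_pow_iff_of_mul_eq hdualP]
    clear hCcard hCT hCP hCD hdual hdualT hdualD hdualP hcardT hcardQ hcardD
    push_cast
    constructor
    · rintro ⟨h1, h2, h3, h4, h5⟩
      omega
    · rintro ⟨h1, h2, h3, h4, h5⟩
      omega
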